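/- Let $X$ be a locally compact Hausdorff space with its Borel $\sigma$-algebra, let $k : X\times X\to\mathbb{R}$ be a kernel, i.e. a symmetric positive definite function, and let $\mathcal{H}$ be the reproducing kernel Hilbert space of functions on $X$ induced by $k$. Let $M_b(X)$ be the set of finite signed Radon measures on $X$ (signed Borel measures $\mu$ whose total variation $|\mu|$ is finite and satisfies $|\mu|(B)=\sup\{|\mu|(C): C\subset B,\ C \text{ compact}\}$ for every Borel set $B$), and let $M_{bc}(X)$ be the set of those $\mu\in M_b(X)$ whose support (the set of points all of whose open neighbourhoods $U$ satisfy $|\mu|(U)\neq 0$) is compact. Write $C_b$ for bounded continuous functions and $C_0(X)$ for continuous functions vanishing at infinity. The kernel $k$ is called - $c$-universal ($X$ compact) if $k$ is continuous and $\mathcal{H}$ is dense in $C(X)$ in the uniform norm; - $cc$-universal if $k$ is continuous and, for every compact $Z\subset X$, every $g\in C(Z)$ and every $\epsilon>0$, there is $f\in\mathcal{H}$ with $\sup_{z\in Z}|f(z)-g(z)|\le\epsilon$; - $c_0$-universal if $k$ is bounded, $k(\cdot,x)\in C_0(X)$ for all $x\in X$, and $\mathcal{H}$ is dense in $C_0(X)$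 in the uniform norm; - strictly positive definite if for all $n$, all mutually distinct $x_1,\dots,x_n\in X$ and all $\alpha_1,\dots,\alpha_n\in\mathbb{R}$, $\sum_{l,j}\alpha_l\alpha_j k(x_l,x_j)=0$ only if $\alpha_1=\dots=\alpha_n=0$. Then: (a) If $X$ is compact and $k$ is continuous, then $k$ is $c$-universal if and only if $\int_X\!\int_X k(x,y)\,d\mu(x)\,d\mu(y)>0$ for all $0\ne\mu\in M_b(X)$. (b) If $k\in C_b(X\times X)$, then $k$ is $cc$-universal if and only if $\int_X\!\int_X k(x,y)\,d\mu(x)\,d\mu(y)>0$ for all $0\ne\mu\in M_{bc}(X)$. (c) If $k$ is bounded and $k(\cdot,x)\in C_0(X)$ for all $x\in X$, then $k$ is $c_0$-universal if and only if $\int_X\!\int_X k(x,y)\,d\mu(x)\,d\mu(y)>0$ for all $0\ne\mu\in M_b(X)$. (d) Under the respective assumptions of (a), (b), (c): if $k$ is $c$-universal, $cc$-universal or $c_0$-universal, then $k$ is strictly positive definite. -/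

import Mathlib

open MeasureTheory
open scoped ZeroAtInfty

/-- A function `k : X × X → ℝ` is positive definite if it is symmetric and
`∑ l, ∑ j, α l * α j * k (x l) (x j) ≥ 0` for all finite families of points `x` and reals `α`. -/
def IsPosDef {X : Type*} (k : X → X → ℝ) : Prop :=
  (∀ x y, k x y = k y x) ∧
    ∀ (n : ℕ) (x : Fin n → X) (α : Fin n → ℝ), 0 ≤ ∑ l, ∑ j, α l * α j * k (x l) (x j)

/-- `k` is strictly positive definite if it is positive definite and, for mutually distinct points,
the quadratic form vanishes only for zero coefficients. -/
def IsStrictlyPosDef {X : Type*} (k : X → X → ℝ) : Prop :=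
  IsPosDef k ∧
    ∀ (n : ℕ) (x : Fin n → X) (α : Fin n → ℝ), Function.Injective x →
      ∑ l, ∑ j, α l * α j * k (x l) (x j) = 0 → ∀ j, α j = 0

/-- A (real reproducing) kernel on `X`: a positive definite function. -/
structure PDKernel (X : Type*) where
  toFun : X → X → ℝ
  isPosDef : IsPosDef toFun

namespace PDKernel

variable {X : Type*}

instance : CoeFun (PDKernel X) (fun _ => X → X → ℝ) := ⟨PDKernel.toFun⟩

/-- The kernel as an operator-valued matrix: the entry at `(x, y)` is multiplication by `k x y`. -/
noncomputable def opMatrix (k : PDKernel X) : Matrix X X (ℝ →L[ℝ] ℝ) :=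
  Matrix.of fun x y => k x y • ContinuousLinearMap.id ℝ ℝ

theorem posSemidef_opMatrix (k : PDKernel X) : k.opMatrix.PosSemidef := by
  have hH : k.opMatrix.IsHermitian := by
    refine Matrix.ext fun x y => ?_
    change star (k y x • (1 : ℝ →L[ℝ] ℝ)) = k x y • (1 : ℝ →L[ℝ] ℝ)
    rw [star_smul, star_one, star_trivial, k.isPosDef.1 x y]
  have t := (RKHS.posSemidef_tfae (K := k.opMatrix)).out 0 2
  refine t.mpr ⟨hH, fun v => ?_⟩
  have h := k.isPosDef.2 v.support.card (fun i => (v.support.equivFin.symm i : X))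
    (fun i => v (v.support.equivFin.symm i : X))
  have e : ∀ f : X → ℝ, ∑ i : Fin v.support.card, f (v.support.equivFin.symm i : X)
      = ∑ x ∈ v.support, f x := fun f => by
    rw [Equiv.sum_comp v.support.equivFin.symm (fun x : v.support => f x)]
    exact Finset.sum_coe_sort v.support f
  have e2 := e (fun x => ∑ i : Fin v.support.card,
    v x * v (v.support.equivFin.symm i : X) * k x (v.support.equivFin.symm i : X))
  rw [e2] at h
  simp only [fun x => e (fun y => v x * v y * k x y)] at h
  refine h.trans (le_of_eq ?_)
  simp only [Finsupp.sum, RCLike.re_to_real]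
  refine Finset.sum_congr rfl fun x _ => Finset.sum_congr rfl fun y _ => ?_
  simp [opMatrix, k.isPosDef.1 x y]
  ring

instance (k : PDKernel X) : Fact k.opMatrix.PosSemidef := ⟨k.posSemidef_opMatrix⟩

/-- The reproducing kernel Hilbert space of functions on `X` induced by `k`. An element `f` is
evaluated at a point by `f x`. -/
abbrev Space (k : PDKernel X) : Type _ := RKHS.OfKernel k.opMatrix

/-- The reproducing kernel of `k.Space` is `k`. -/
theorem kernel_space (k : PDKernel X) (x y : X) : RKHS.kernel k.Space x y 1 = k x y := by
  rw [RKHS.OfKernel.kernel_ofKernel]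
  simp [opMatrix]

/-- `k ∈ C_b(X × X)`. -/
def IsBoundedContinuous [TopologicalSpace X] (k : PDKernel X) : Prop :=
  Continuous (fun p : X × X => k p.1 p.2) ∧ ∃ C : ℝ, ∀ x y, |k x y| ≤ C

/-- `k` is bounded, and `k(·, x) ∈ C₀(X)` for all `x`. -/
def IsBoundedC0 [TopologicalSpace X] (k : PDKernel X) : Prop :=
  (∃ C : ℝ, ∀ x y, |k x y| ≤ C) ∧ ∀ x, ∃ f : C₀(X, ℝ), ∀ y, f y = k y x

/-- `k` is continuous and its RKHS is dense in `C(X)` for the uniform norm (used for `X` compact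
Hausdorff). -/
def IsCUniversal [TopologicalSpace X] (k : PDKernel X) : Prop :=
  Continuous (fun p : X × X => k p.1 p.2) ∧
    ∀ g : C(X, ℝ), ∀ ε > 0, ∃ f : k.Space, ∀ x, |f x - g x| ≤ ε

/-- `k` is continuous and its RKHS is dense in `C(X)` for the topology of compact convergence:
for each compact `Z`, the restrictions to `Z` are uniformly dense in `C(Z)`. -/
def IsCCUniversal [TopologicalSpace X] (k : PDKernel X) : Prop :=
  Continuous (fun p : X × X => k p.1 p.2) ∧
    ∀ Z : Set X, IsCompact Z → ∀ g : C(Z, ℝ), ∀ ε > 0, ∃ f : k.Space, ∀ z : Z, |f z - g z| ≤ ε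

/-- `k` is bounded with `k(·, x) ∈ C₀(X)`, and its RKHS is dense in `C₀(X)` for the uniform norm. -/
def IsC0Universal [TopologicalSpace X] (k : PDKernel X) : Prop :=
  k.IsBoundedC0 ∧
    ∀ g : C₀(X, ℝ), ∀ ε > 0, ∃ f : k.Space, ∀ x, |f x - g x| ≤ ε

/-- `∬ k(x, y) dμ(x) dμ(y)`, as an iterated integral against the signed measure `μ`. -/
noncomputable def energy [MeasurableSpace X] (k : PDKernel X) (μ : SignedMeasure X) : ℝ :=
  ∫ᵛ y, (∫ᵛ x, k x y ∂<•μ) ∂<•μ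

end PDKernel

/-- `M_b(X)`: the finite signed Radon measures on `X`, i.e. the signed Borel measures whose total
variation (always finite) is inner regular with respect to compact sets on all Borel sets. -/
def Mb (X : Type*) [TopologicalSpace X] [MeasurableSpace X] : Set (SignedMeasure X) :=
  {μ | μ.totalVariation.InnerRegular}

/-- `M_bc(X)`: the finite signed Radon measures on `X` with compact support. -/
def Mbc (X : Type*) [TopologicalSpace X] [MeasurableSpace X] : Set (SignedMeasure X) :=
  {μ | μ ∈ Mb X ∧ IsCompact μ.totalVariation.support}

/-! For a bounded kernel with continuous sections, `f ↦ ∫ f dμ` is a bounded functional on the RKHS.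
By the reproducing property its Riesz representer is `h(y) = ∫ k(x,y) dμ(x)`, so the energy of `μ`
is `∫ h dμ = ‖h‖²`. Hence it is positive exactly when `μ` does not annihilate the RKHS
(`energy_pos_iff`), and each criterion says that density means having no nonzero annihilating
measure.

Density gives this by approximating test functions in `C_c(X)`, which determine a Radon measure. The
converse is Hahn–Banach together with the Riesz representation of the dual of `C₀`
(`exists_mem_abs_sub_le_of_separating`). The compact case is the `C₀` case, and the `cc` case runs
the argument on each compact `Z`, pushing measures on `Z` forward to `X`.

Strict positive definiteness is the analogue for point masses: a vanishing quadratic form forces `∑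
α_j f(x_j) = 0` on the RKHS, and approximating a bump at `x_i` isolates `α_i`. -/

/-! ### Riesz representation of bounded functionals on `C_c` and `C₀`. -/

section SignedRiesz

open CompactlySupported CompactlySupportedContinuousMap
open scoped NNReal ENNReal

variable {X : Type*} [TopologicalSpace X]

/-- The positive part of a linear functional on `C_c(X, ℝ)`:
`f ↦ sup {l g | 0 ≤ g ≤ f}`. -/
noncomputable def posPartFun (l : C_c(X, ℝ) →ₗ[ℝ] ℝ) (f : C_c(X, ℝ≥0)) : ℝ :=
  sSup (l '' {g | 0 ≤ g ∧ g ≤ f.toReal})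

variable {l : C_c(X, ℝ) →ₗ[ℝ] ℝ} {M : ℝ}

theorem posPartFun_le {f : C_c(X, ℝ≥0)} {a : ℝ} (h : ∀ g, 0 ≤ g → g ≤ f.toReal → l g ≤ a) :
    posPartFun l f ≤ a := by
  refine csSup_le ⟨_, 0, ⟨le_rfl, toReal_nonneg⟩, rfl⟩ ?_
  rintro _ ⟨g, ⟨h0, h1⟩, rfl⟩
  exact h g h0 h1

theorem apply_le_mul (hl : ∀ f c, (∀ x, |f x| ≤ c) → |l f| ≤ M * c) {f : C_c(X, ℝ≥0)}
    {g : C_c(X, ℝ)} {c : ℝ} (hf : ∀ x, (f x : ℝ) ≤ c) (h0 : 0 ≤ g) (h1 : g ≤ f.toReal) :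
    l g ≤ M * c := by
  refine (le_abs_self _).trans (hl _ _ fun x => ?_)
  rw [abs_of_nonneg (h0 x)]
  exact (h1 x).trans (by simpa using hf x)

theorem exists_bound (f : C_c(X, ℝ≥0)) : ∃ c : ℝ, ∀ x, (f x : ℝ) ≤ c := by
  obtain ⟨c, hc⟩ := f.toReal.hasCompactSupport.exists_bound_of_continuous f.toReal.continuous
  exact ⟨c, fun x => (le_abs_self _).trans (by simpa using hc x)⟩

theorem le_posPartFun (hl : ∀ f c, (∀ x, |f x| ≤ c) → |l f| ≤ M * c) {f : C_c(X, ℝ≥0)}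
    {g : C_c(X, ℝ)} (h0 : 0 ≤ g) (h1 : g ≤ f.toReal) : l g ≤ posPartFun l f := by
  obtain ⟨c, hc⟩ := exists_bound f
  refine le_csSup ⟨M * c, ?_⟩ ⟨g, ⟨h0, h1⟩, rfl⟩
  rintro _ ⟨g, ⟨h0, h1⟩, rfl⟩
  exact apply_le_mul hl hc h0 h1

theorem posPartFun_nonneg (hl : ∀ f c, (∀ x, |f x| ≤ c) → |l f| ≤ M * c) (f : C_c(X, ℝ≥0)) :
    0 ≤ posPartFun l f := by
  simpa using le_posPartFun hl le_rfl (toReal_nonneg (f := f))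

/-- Riesz decomposition: any `0 ≤ g ≤ f₁ + f₂` splits as `g ⊓ f₁` plus a nonnegative remainder below
`f₂`. -/
theorem posPartFun_add (hl : ∀ f c, (∀ x, |f x| ≤ c) → |l f| ≤ M * c) (f₁ f₂ : C_c(X, ℝ≥0)) :
    posPartFun l (f₁ + f₂) = posPartFun l f₁ + posPartFun l f₂ := by
  refine le_antisymm (posPartFun_le fun g h0 h1 => ?_) ?_
  · have h2 : g = g ⊓ f₁.toReal + (g - g ⊓ f₁.toReal) := by abel
    rw [h2, map_add]
    refine add_le_add (le_posPartFun hl (le_inf h0 toReal_nonneg) inf_le_right)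
      (le_posPartFun hl (sub_nonneg.2 inf_le_left) fun x => ?_)
    have h3 := h1 x
    have h4 : (0 : ℝ) ≤ f₂ x := NNReal.coe_nonneg _
    simp only [toReal_add, coe_add, Pi.add_apply, toReal_apply, coe_sub, Pi.sub_apply,
      inf_apply] at h3 ⊢
    rcases min_cases (g x) (f₁ x : ℝ) with h | h <;> linarith
  · rw [← le_sub_iff_add_le]
    refine posPartFun_le fun g₁ h0 h1 => ?_
    rw [le_sub_comm]
    refine posPartFun_le fun g₂ h0' h1' => ?_
    rw [le_sub_iff_add_le', ← map_add]
    exact le_posPartFun hl (add_nonneg h0 h0') (by simpa using add_le_add h1 h1')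

theorem le_posPartFun_smul (hl : ∀ f c, (∀ x, |f x| ≤ c) → |l f| ≤ M * c) (r : ℝ≥0)
    (f : C_c(X, ℝ≥0)) : r * posPartFun l f ≤ posPartFun l (r • f) := by
  rcases eq_or_ne r 0 with rfl | hr
  · simpa using posPartFun_nonneg hl _
  have hr' : (0 : ℝ) < r := by positivity
  rw [← le_div_iff₀' hr']
  refine posPartFun_le fun g h0 h1 => ?_
  rw [le_div_iff₀' hr', ← smul_eq_mul, ← map_smul]
  refine le_posPartFun hl (fun x => ?_) fun x => ?_
  · simpa using mul_nonneg hr'.le (h0 x)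
  · simpa [NNReal.smul_def] using mul_le_mul_of_nonneg_left (h1 x) hr'.le

theorem posPartFun_smul (hl : ∀ f c, (∀ x, |f x| ≤ c) → |l f| ≤ M * c) (r : ℝ≥0)
    (f : C_c(X, ℝ≥0)) : posPartFun l (r • f) = r * posPartFun l f := by
  refine le_antisymm ?_ (le_posPartFun_smul hl r f)
  rcases eq_or_ne r 0 with rfl | hr
  · refine posPartFun_le fun g h0 h1 => ?_
    have : g = 0 := le_antisymm (h1.trans fun x => by simp) h0
    simp [this]
  -- The reverse inequality is the one already proved, applied to the inverse scalar.
  have h := le_posPartFun_smul hl r⁻¹ (r • f)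
  rw [smul_smul, inv_mul_cancel₀ hr, one_smul, NNReal.coe_inv, inv_mul_le_iff₀ (by positivity)] at h
  exact h

/-- The positive part of a bounded functional as an `ℝ≥0`-linear functional. -/
noncomputable def posPartLinear (l : C_c(X, ℝ) →ₗ[ℝ] ℝ)
    (hl : ∀ f c, (∀ x, |f x| ≤ c) → |l f| ≤ M * c) : C_c(X, ℝ≥0) →ₗ[ℝ≥0] ℝ≥0 where
  toFun f := ⟨posPartFun l f, posPartFun_nonneg hl f⟩
  map_add' f g := NNReal.eq (posPartFun_add hl f g)
  map_smul' r f := NNReal.eq (posPartFun_smul hl r f)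

/-- The negative part of a bounded functional as an `ℝ≥0`-linear functional. -/
noncomputable def negPartLinear (l : C_c(X, ℝ) →ₗ[ℝ] ℝ)
    (hl : ∀ f c, (∀ x, |f x| ≤ c) → |l f| ≤ M * c) : C_c(X, ℝ≥0) →ₗ[ℝ≥0] ℝ≥0 where
  toFun f := ⟨posPartFun l f - l f.toReal, sub_nonneg.2 (le_posPartFun hl toReal_nonneg le_rfl)⟩
  map_add' f g := NNReal.eq <| by
    change posPartFun l (f + g) - l (f + g).toReal = (posPartFun l f - l f.toReal) +
      (posPartFun l g - l g.toReal)
    rw [posPartFun_add hl, toReal_add, map_add]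
    ring
  map_smul' r f := NNReal.eq <| by
    change posPartFun l (r • f) - l (r • f).toReal = r * (posPartFun l f - l f.toReal)
    rw [posPartFun_smul hl, toReal_smul, NNReal.smul_def, map_smul, smul_eq_mul]
    ring

theorem integrable_zeroAtInfty [MeasurableSpace X] [BorelSpace X] (μ : Measure X)
    [IsFiniteMeasure μ] (f : C₀(X, ℝ)) :
    Integrable f μ :=
  f.toBCF.integrable μ

theorem integrable_compactlySupported [MeasurableSpace X] [BorelSpace X] (μ : Measure X)
    [IsFiniteMeasure μ] (f : C_c(X, ℝ)) :
    Integrable f μ :=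
  f.toBoundedContinuousFunction.integrable μ

theorem abs_integral_sub_integral_le {Ω : Type*} [MeasurableSpace Ω] (μ : Measure Ω)
    [IsFiniteMeasure μ] {f g : Ω → ℝ} {ε : ℝ}
    (hf : Integrable f μ) (hg : Integrable g μ) (h : ∀ x, |f x - g x| ≤ ε) :
    |∫ x, f x ∂μ - ∫ x, g x ∂μ| ≤ ε * μ.real Set.univ := by
  rw [← integral_sub hf hg, ← Real.norm_eq_abs]
  exact norm_integral_le_of_norm_le_const (.of_forall h)

variable [T2Space X] [LocallyCompactSpace X]

/-- Multiply `f` by a cutoff equal to 1 on a compact set off which `|f| ≤ ε`. -/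
theorem exists_compactlySupported_abs_sub_le (f : C₀(X, ℝ)) {ε : ℝ} (hε : 0 < ε) :
    ∃ g : C_c(X, ℝ), ∀ x, |f x - g x| ≤ ε := by
  have hf := f.zero_at_infty'
  have h1 := hf (Metric.closedBall_mem_nhds 0 hε)
  obtain ⟨K, hK, hKf⟩ := Filter.mem_cocompact.1 h1
  obtain ⟨u, h1, -, hc, hu⟩ := exists_continuous_one_zero_of_isCompact hK isClosed_empty
    (Set.disjoint_empty K)
  refine ⟨⟨⟨fun x => u x * f x, by fun_prop⟩, hc.mul_right⟩, fun x => ?_⟩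
  change |f x - u x * f x| ≤ ε
  by_cases hx : x ∈ K
  · simp [h1 hx, hε.le]
  · have h2 : |f x| ≤ ε := by simpa using hKf hx
    rw [← one_sub_mul, abs_mul, abs_of_nonneg (sub_nonneg.2 (hu x).2)]
    exact (mul_le_of_le_one_left (abs_nonneg _) (by linarith [(hu x).1])).trans h2

variable [MeasurableSpace X] [BorelSpace X]

theorem rieszMeasure_univ_le (Λ : C_c(X, ℝ) →ₚ[ℝ] ℝ)
    (h : ∀ f : C_c(X, ℝ), (∀ x, 0 ≤ f x) → (∀ x, f x ≤ 1) → Λ f ≤ M) :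
    RealRMK.rieszMeasure Λ Set.univ ≤ ENNReal.ofReal M := by
  rw [isOpen_univ.measure_eq_iSup_isCompact]
  refine iSup₂_le fun K _ => iSup_le fun hK => ?_
  obtain ⟨f, h1, -, hc, hf⟩ := exists_continuous_one_zero_of_isCompact hK isClosed_empty
    (Set.disjoint_empty K)
  refine (RealRMK.rieszMeasure_le_of_eq_one Λ (f := ⟨f, hc⟩) (fun x => (hf x).1) hK h1).trans ?_
  exact ENNReal.ofReal_le_ofReal (h _ (fun x => (hf x).1) fun x => (hf x).2)

theorem exists_regular_integral_sub_of_bounded (l : C_c(X, ℝ) →ₗ[ℝ] ℝ)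
    (hl : ∀ f c, (∀ x, |f x| ≤ c) → |l f| ≤ M * c) :
    ∃ μ ν : Measure X, IsFiniteMeasure μ ∧ IsFiniteMeasure ν ∧ μ.Regular ∧ ν.Regular ∧
      ∀ f : C_c(X, ℝ), l f = ∫ x, f x ∂μ - ∫ x, f x ∂ν := by
  let P := toRealPositiveLinear (posPartLinear l hl)
  let N := toRealPositiveLinear (negPartLinear l hl)
  have hP (f : C_c(X, ℝ)) : P f = posPartFun l f.nnrealPart - posPartFun l (-f).nnrealPart := rfl
  have hN (f : C_c(X, ℝ)) : N f = (posPartFun l f.nnrealPart - l f.nnrealPart.toReal) -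
      (posPartFun l (-f).nnrealPart - l (-f).nnrealPart.toReal) := rfl
  have key (f : C_c(X, ℝ)) : l f = P f - N f := by
    conv_lhs => rw [← nnrealPart_sub_nnrealPart_neg f, map_sub]
    rw [hP, hN]
    ring
  have bP (f : C_c(X, ℝ)) (h0 : ∀ x, 0 ≤ f x) (h1 : ∀ x, f x ≤ 1) : P f ≤ M := by
    rw [hP]
    have h2 := posPartFun_nonneg hl (-f).nnrealPart
    have h3 : posPartFun l f.nnrealPart ≤ M * 1 :=
      posPartFun_le fun g hg hg' => apply_le_mul hl (fun x => by simp [h1 x]) hg hg'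
    linarith
  -- Since `N = P - l`, the bounds `P f ≤ M` and `-l f ≤ M` add up to `2 * M`.
  have bN (f : C_c(X, ℝ)) (h0 : ∀ x, 0 ≤ f x) (h1 : ∀ x, f x ≤ 1) : N f ≤ 2 * M := by
    have h2 := key f
    have h3 := bP f h0 h1
    have h4 := neg_le_of_abs_le (hl f 1 fun x => by rw [abs_of_nonneg (h0 x)]; exact h1 x)
    linarith
  refine ⟨RealRMK.rieszMeasure P, RealRMK.rieszMeasure N,
    ⟨(rieszMeasure_univ_le P bP).trans_lt ENNReal.ofReal_lt_top⟩,
    ⟨(rieszMeasure_univ_le N bN).trans_lt ENNReal.ofReal_lt_top⟩, inferInstance, inferInstance,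
    fun f => ?_⟩
  rw [RealRMK.integral_rieszMeasure, RealRMK.integral_rieszMeasure, key]

/-- **Riesz representation** of bounded functionals on `C₀(X)`. -/
theorem exists_regular_integral_sub (L : C₀(X, ℝ) →L[ℝ] ℝ) :
    ∃ μ ν : Measure X, IsFiniteMeasure μ ∧ IsFiniteMeasure ν ∧ μ.Regular ∧ ν.Regular ∧
      ∀ f : C₀(X, ℝ), L f = ∫ x, f x ∂μ - ∫ x, f x ∂ν := by
  have hL (f : C₀(X, ℝ)) (c : ℝ) (hc : 0 ≤ c) (h : ∀ x, |f x| ≤ c) : |L f| ≤ ‖L‖ * c := by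
    refine L.le_opNorm_of_le ?_
    rw [← ZeroAtInftyContinuousMap.norm_toBCF_eq_norm]
    exact (BoundedContinuousFunction.norm_le hc).2 h
  let l : C_c(X, ℝ) →ₗ[ℝ] ℝ :=
    { toFun f := L (f : C₀(X, ℝ))
      map_add' f g := by rw [← map_add]; rfl
      map_smul' r f := by rw [← map_smul]; rfl }
  have hl (f : C_c(X, ℝ)) (c : ℝ) (h : ∀ x, |f x| ≤ c) : |l f| ≤ ‖L‖ * c := by
    -- On an empty space `c` may be negative, and the bound survives only because `‖L‖ = 0`.
    rcases isEmpty_or_nonempty X with hX | ⟨⟨x⟩⟩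
    · have h0 : L = 0 := by
        ext f
        rw [ZeroAtInftyContinuousMap.eq_of_empty f 0, map_zero, map_zero]
      rw [h0, ContinuousLinearMap.opNorm_zero]
      simp [l, h0]
    · exact hL _ c ((abs_nonneg _).trans (h x)) h
  obtain ⟨μ, ν, hμ, hν, hμr, hνr, h⟩ := exists_regular_integral_sub_of_bounded l hl
  refine ⟨μ, ν, hμ, hν, hμr, hνr, fun f => eq_of_forall_dist_le fun ε hε => ?_⟩
  -- Replacing `f` by a compactly supported `g` costs `ε / C` times each of the first three terms;
  -- the extra 1 makes `C` positive.
  let C := ‖L‖ + μ.real Set.univ + ν.real Set.univ + 1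
  have hC : 0 < C := by positivity
  obtain ⟨g, hg⟩ := exists_compactlySupported_abs_sub_le f (div_pos hε hC)
  have h1 : |L f - l g| ≤ ‖L‖ * (ε / C) := by
    change |L f - L (g : C₀(X, ℝ))| ≤ _
    rw [← map_sub]
    exact hL _ _ (by positivity) hg
  have h2 := abs_integral_sub_integral_le μ (integrable_zeroAtInfty μ f)
    (integrable_compactlySupported μ g) hg
  have h3 := abs_integral_sub_integral_le ν (integrable_zeroAtInfty ν f)
    (integrable_compactlySupported ν g) hg
  have h4 : ε / C * C = ε := div_mul_cancel₀ _ hC.ne'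
  have h5 : 0 < ε / C := by positivity
  rw [h g] at h1
  rw [Real.dist_eq]
  rw [abs_le] at *
  simp only [C] at *
  constructor <;> nlinarith

end SignedRiesz

/-! ### Signed Radon measures: regularity, and determination by `C_c`. -/

section SignedMeasure

open CompactlySupported
open scoped ENNReal

variable {X : Type*}

section Measurable

variable [MeasurableSpace X]

theorem isFiniteMeasure_variation (μ : SignedMeasure X) : IsFiniteMeasure μ.variation := by
  rw [← SignedMeasure.totalVariation_eq_variation]
  infer_instance

theorem signedIntegral_sub {p n : Measure X} [IsFiniteMeasure p] [IsFiniteMeasure n] {f : X → ℝ}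
    (hp : Integrable f p) (hn : Integrable f n) :
    ∫ᵛ x, f x ∂<•(p.toSignedMeasure - n.toSignedMeasure) = ∫ x, f x ∂p - ∫ x, f x ∂n := by
  rw [VectorMeasure.integral_sub_vectorMeasure, VectorMeasure.integral_toSignedMeasure,
    VectorMeasure.integral_toSignedMeasure]
  · simpa [VectorMeasure.Integrable] using hp
  · simpa [VectorMeasure.Integrable] using hn

theorem totalVariation_sub_le (p n : Measure X) [IsFiniteMeasure p] [IsFiniteMeasure n] :
    (p.toSignedMeasure - n.toSignedMeasure).totalVariation ≤ p + n := by
  rw [SignedMeasure.totalVariation_eq_variation]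
  simpa using VectorMeasure.variation_sub_le (μ := p.toSignedMeasure) (ν := n.toSignedMeasure)

theorem toSignedMeasure_sub_eq_zero_iff {p n : Measure X} [IsFiniteMeasure p]
    [IsFiniteMeasure n] : p.toSignedMeasure - n.toSignedMeasure = 0 ↔ p = n := by
  rw [sub_eq_zero, Measure.toSignedMeasure_eq_toSignedMeasure_iff]

end Measurable

variable [TopologicalSpace X] [MeasurableSpace X] [BorelSpace X]

/-- A compact `K ⊆ U` with `q (U \ K) < p U - r` also has `p (U \ K) < p U - r`, hence `r < p K`. -/
theorem innerRegular_of_le [T2Space X] {p q : Measure X} [IsFiniteMeasure q] [q.InnerRegular]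
    (h : p ≤ q) : p.InnerRegular := by
  refine ⟨fun U hU r hr => ?_⟩
  have : IsFiniteMeasure p := isFiniteMeasure_of_le q h
  obtain ⟨K, hKU, hK, hlt⟩ := hU.exists_isCompact_sdiff_lt (measure_ne_top q U)
    (tsub_pos_of_lt hr).ne'
  refine ⟨K, hKU, hK, ?_⟩
  have h1 : p U ≤ p (U \ K) + p K := by
    rw [add_comm]
    exact (measure_mono (by rw [Set.union_sdiff_self]; exact Set.subset_union_right)).trans
      (measure_union_le K (U \ K))
  have h2 : p (U \ K) < p U - r := (h _).trans_lt hlt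
  have h3 : p U ≤ p K + p (U \ K) := h1.trans_eq (add_comm _ _)
  by_contra! h4
  have h5 : p U < r + (p U - r) :=
    h3.trans_lt (ENNReal.add_lt_add_of_le_of_lt (measure_ne_top _ _) h4 h2)
  rw [add_tsub_cancel_of_le hr.le] at h5
  exact lt_irrefl _ h5

theorem sub_mem_Mb [T2Space X] (p n : Measure X) [IsFiniteMeasure p] [IsFiniteMeasure n]
    [p.InnerRegular] [n.InnerRegular] : p.toSignedMeasure - n.toSignedMeasure ∈ Mb X :=
  innerRegular_of_le (totalVariation_sub_le p n)

theorem integrable_variation_of_bounded {μ : SignedMeasure X} {f : X → ℝ} (hf : Continuous f)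
    {C : ℝ} (hC : ∀ x, |f x| ≤ C) : Integrable f μ.variation :=
  have := isFiniteMeasure_variation μ
  (BoundedContinuousFunction.ofNormedAddCommGroup f hf C hC).integrable _

/-- Both Jordan parts lie below the total variation, so they are inner regular and are determined by
their integrals over `C_c`. -/
theorem eq_zero_of_signedIntegral_eq_zero [T2Space X] [LocallyCompactSpace X]
    {μ : SignedMeasure X} (hμ : μ ∈ Mb X) (h : ∀ g : C_c(X, ℝ), ∫ᵛ x, g x ∂<•μ = 0) : μ = 0 := by
  have hr : μ.totalVariation.InnerRegular := hμ
  have h1 : μ.toJordanDecomposition.posPart.InnerRegular :=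
    innerRegular_of_le (q := μ.totalVariation) (Measure.le_add_right le_rfl)
  have h2 : μ.toJordanDecomposition.negPart.InnerRegular :=
    innerRegular_of_le (q := μ.totalVariation) (Measure.le_add_left le_rfl)
  rw [← SignedMeasure.toSignedMeasure_toJordanDecomposition μ,
    JordanDecomposition.toSignedMeasure] at h ⊢
  rw [toSignedMeasure_sub_eq_zero_iff]
  refine Measure.ext_of_integral_eq_on_compactlySupported fun g => ?_
  rw [← sub_eq_zero, ← signedIntegral_sub (integrable_compactlySupported _ g)
    (integrable_compactlySupported _ g), h g]

end SignedMeasure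

/-! ### Density by Hahn–Banach duality. -/

section Density

variable {X : Type*} [TopologicalSpace X] [T2Space X] [LocallyCompactSpace X] [MeasurableSpace X]
  [BorelSpace X]

/-- A subspace of `C₀(X)` that separates the finite regular measures is uniformly dense. -/
theorem exists_mem_abs_sub_le_of_separating (S : Submodule ℝ C₀(X, ℝ))
    (hS : ∀ p n : Measure X, IsFiniteMeasure p → IsFiniteMeasure n → p.Regular → n.Regular →
      (∀ f ∈ S, ∫ x, f x ∂p = ∫ x, f x ∂n) → p = n) (g : C₀(X, ℝ)) {ε : ℝ} (hε : 0 < ε) :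
    ∃ f ∈ S, ∀ x, |f x - g x| ≤ ε := by
  have hg : g ∈ closure (S : Set C₀(X, ℝ)) := by
    by_contra hg
    obtain ⟨L, u, h1, h2⟩ := geometric_hahn_banach_closed_point
      (S.topologicalClosure.convex) S.isClosed_topologicalClosure hg
    -- A functional bounded above on a subspace vanishes there: otherwise rescaling `f` attains the
    -- strict bound `u`.
    have h3 : ∀ f ∈ S, L f = 0 := fun f hf => by
      by_contra h0
      have h4 := h1 _ (S.le_topologicalClosure (S.smul_mem (u / L f) hf))
      rw [map_smul, smul_eq_mul, div_mul_cancel₀ _ h0] at h4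
      exact lt_irrefl _ h4
    have h0 := h1 0 (zero_mem _)
    rw [map_zero] at h0
    obtain ⟨p, n, hp, hn, hpr, hnr, h⟩ := exists_regular_integral_sub L
    have h5 : p = n := hS p n hp hn hpr hnr fun f hf => by rw [← sub_eq_zero, ← h, h3 f hf]
    rw [h g, h5, sub_self] at h2
    exact lt_asymm h0 h2
  obtain ⟨f, hf, hd⟩ := Metric.mem_closure_iff.1 hg ε hε
  refine ⟨f, hf, fun x => ?_⟩
  rw [dist_comm, ← ZeroAtInftyContinuousMap.dist_toBCF_eq_dist] at hd
  exact (BoundedContinuousFunction.dist_coe_le_dist x).trans hd.le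

end Density

/-! ### The RKHS of a bounded kernel and the embedding of measures into it. -/

namespace PDKernel

open CompactlySupported
open scoped InnerProductSpace

variable {X : Type*} (k : PDKernel X)

/-- The element `k(·, y)` of the reproducing kernel Hilbert space. -/
noncomputable def kerSection (y : X) : k.Space := RKHS.kerFun k.Space y 1

theorem kerSection_apply (x y : X) : k.kerSection y x = k x y := by
  rw [kerSection, RKHS.kerFun_apply, kernel_space]

theorem inner_kerSection (f : k.Space) (x : X) : ⟪f, k.kerSection x⟫_ℝ = f x := by
  simp [kerSection]

theorem kerSection_inner (f : k.Space) (x : X) : ⟪k.kerSection x, f⟫_ℝ = f x := by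
  rw [real_inner_comm, inner_kerSection]

theorem span_kerSection_dense :
    (Submodule.span ℝ (Set.range k.kerSection)).topologicalClosure = ⊤ := by
  rw [eq_top_iff, ← RKHS.kerFun_dense k.Space]
  refine Submodule.topologicalClosure_mono (Submodule.span_le.2 ?_)
  rintro _ ⟨x, v, rfl⟩
  have : RKHS.kerFun k.Space x v = v • k.kerSection x := by
    rw [kerSection, ← map_smul, smul_eq_mul, mul_one]
  rw [this]
  exact Submodule.smul_mem _ _ (Submodule.subset_span ⟨x, rfl⟩)

variable {k}

/-- Cauchy–Schwarz with `‖k(·, x)‖² = k x x ≤ C`; thus convergence in the RKHS is uniform. -/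
theorem abs_apply_le {C : ℝ} (hC : ∀ x y, |k x y| ≤ C) (f : k.Space) (x : X) :
    |f x| ≤ ‖f‖ * √C := by
  rw [← inner_kerSection]
  refine (abs_real_inner_le_norm _ _).trans (mul_le_mul_of_nonneg_left ?_ (norm_nonneg _))
  refine Real.le_sqrt_of_sq_le ?_
  rw [← real_inner_self_eq_norm_sq, inner_kerSection, kerSection_apply]
  exact (le_abs_self _).trans (hC x x)

/-- A property of functions that is linear, stable under uniform limits and holds for the sections
of a bounded kernel holds on the whole reproducing kernel Hilbert space. -/
theorem induction_of_bounded {C : ℝ} (hC : ∀ x y, |k x y| ≤ C) (S : Submodule ℝ (X → ℝ))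
    (hk : ∀ y, (fun x => k x y) ∈ S)
    (hS : ∀ f : X → ℝ, (∀ ε > 0, ∃ g ∈ S, ∀ x, |f x - g x| ≤ ε) → f ∈ S) (f : k.Space) :
    ⇑f ∈ S := by
  let T : Submodule ℝ k.Space := S.comap (RKHS.coeCLM ℝ : k.Space →L[ℝ] X → ℝ).toLinearMap
  have hT : Submodule.span ℝ (Set.range k.kerSection) ≤ T := by
    refine Submodule.span_le.2 ?_
    rintro _ ⟨y, rfl⟩
    change ⇑(k.kerSection y) ∈ S
    rw [show ⇑(k.kerSection y) = fun x => k x y from funext fun x => k.kerSection_apply x y]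
    exact hk y
  have hf : f ∈ closure (T : Set k.Space) := by
    have h : f ∈ (Submodule.span ℝ (Set.range k.kerSection)).topologicalClosure := by
      rw [k.span_kerSection_dense]
      trivial
    exact closure_mono hT h
  refine hS f fun ε hε => ?_
  have hC1 : 0 < √C + 1 := by positivity
  obtain ⟨g, hg, hd⟩ := Metric.mem_closure_iff.1 hf (ε / (√C + 1)) (by positivity)
  refine ⟨g, hg, fun x => ?_⟩
  have h := abs_apply_le hC (f - g) x
  rw [RKHS.coe_sub, Pi.sub_apply] at h
  rw [dist_eq_norm, lt_div_iff₀ hC1] at hd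
  exact h.trans ((mul_le_mul_of_nonneg_left (by linarith) (norm_nonneg _)).trans hd.le)

section Topology

variable [TopologicalSpace X]

theorem continuous_apply {C : ℝ} (hC : ∀ x y, |k x y| ≤ C)
    (hk : ∀ y, Continuous fun x => k x y) (f : k.Space) : Continuous f := by
  let S : Submodule ℝ (X → ℝ) :=
    { carrier := {f | Continuous f}
      add_mem' := fun h1 h2 => h1.add h2
      zero_mem' := continuous_const
      smul_mem' := fun c _ h => h.const_smul c }
  refine induction_of_bounded hC S hk (fun f hf => ?_) f
  refine continuous_of_uniform_approx_of_continuous fun u hu => ?_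
  obtain ⟨ε, hε, h⟩ := Metric.mem_uniformity_dist.1 hu
  obtain ⟨g, hg, hfg⟩ := hf (ε / 2) (half_pos hε)
  exact ⟨g, hg, fun x => h ((hfg x).trans_lt (half_lt_self hε))⟩

theorem tendsto_cocompact_zero {C : ℝ} (hC : ∀ x y, |k x y| ≤ C)
    (hk : ∀ y, Filter.Tendsto (fun x => k x y) (Filter.cocompact X) (nhds 0)) (f : k.Space) :
    Filter.Tendsto f (Filter.cocompact X) (nhds 0) := by
  let S : Submodule ℝ (X → ℝ) :=
    { carrier := {f | Filter.Tendsto f (Filter.cocompact X) (nhds 0)}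
      add_mem' := fun h1 h2 => (add_zero (0 : ℝ)) ▸ Filter.Tendsto.add h1 h2
      zero_mem' := tendsto_const_nhds
      smul_mem' := fun c _ h => (smul_zero c : c • (0 : ℝ) = 0) ▸ Filter.Tendsto.const_smul h c }
  refine induction_of_bounded hC S hk (fun f hf => ?_) f
  refine Metric.tendsto_nhds.2 fun ε hε => ?_
  obtain ⟨g, hg, hfg⟩ := hf (ε / 2) (half_pos hε)
  filter_upwards [Metric.tendsto_nhds.1 hg (ε / 2) (half_pos hε)] with x hx
  rw [Real.dist_0_eq_abs] at hx ⊢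
  have h1 := abs_add_le (f x - g x) (g x)
  rw [sub_add_cancel] at h1
  linarith [hfg x]

variable [MeasurableSpace X] [BorelSpace X]

/-- The energy is the squared norm of the representer of integration against `μ`. -/
theorem energy_pos_iff {C : ℝ} (hC : ∀ x y, |k x y| ≤ C) (hk : ∀ y, Continuous fun x => k x y)
    (μ : SignedMeasure X) : 0 < k.energy μ ↔ ∃ f : k.Space, ∫ᵛ x, f x ∂<•μ ≠ 0 := by
  have := isFiniteMeasure_variation μ
  have hI (f : k.Space) : Integrable f μ.variation :=
    integrable_variation_of_bounded (continuous_apply hC hk f) (abs_apply_le hC f)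
  let T : k.Space →ₗ[ℝ] ℝ :=
    { toFun f := ∫ᵛ x, f x ∂<•μ
      map_add' f g := by
        rw [RKHS.coe_add]
        exact VectorMeasure.integral_add (hI f) (hI g)
      map_smul' c f := by
        rw [RKHS.coe_smul]
        exact VectorMeasure.integral_smul .. }
  let B : ℝ →L[ℝ] ℝ →L[ℝ] ℝ := (ContinuousLinearMap.lsmul ℝ ℝ).flip
  let T' : k.Space →L[ℝ] ℝ := T.mkContinuous (√C * ‖B‖ * μ.variation.real Set.univ) fun f => by
    refine (VectorMeasure.norm_integral_le_of_norm_le_const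
      (.of_forall (abs_apply_le hC f))).trans_eq ?_
    ring
  let h : k.Space := (InnerProductSpace.toDual ℝ k.Space).symm T'
  have hh (f : k.Space) : ⟪h, f⟫_ℝ = ∫ᵛ x, f x ∂<•μ := InnerProductSpace.toDual_symm_apply
  have hy (y : X) : h y = ∫ᵛ x, k x y ∂<•μ := by
    rw [← inner_kerSection, hh]
    simp_rw [kerSection_apply]
  have he : k.energy μ = ⟪h, h⟫_ℝ := by
    rw [hh, energy]
    simp_rw [hy]
  rw [he, real_inner_self_pos]
  constructor
  · intro h0
    exact ⟨h, by rw [← hh]; exact inner_self_ne_zero.2 h0⟩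
  · rintro ⟨f, hf⟩ h0
    rw [← hh, h0, inner_zero_left] at hf
    exact hf rfl

end Topology

/-- The hypothesis is the common weakening of the three notions of universality: approximation of
`C_c` functions on finite sets. -/
theorem isStrictlyPosDef_of_approx [TopologicalSpace X] [T2Space X] [LocallyCompactSpace X]
    (h : ∀ Z : Set X, Z.Finite → ∀ g : C_c(X, ℝ), ∀ ε > 0, ∃ f : k.Space,
      ∀ z ∈ Z, |f z - g z| ≤ ε) : IsStrictlyPosDef k := by
  refine ⟨k.isPosDef, fun n x α hx h0 i => ?_⟩
  -- The quadratic form is the squared norm of this combination.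
  have hu : ∑ j, α j • k.kerSection (x j) = 0 := by
    rw [← inner_self_eq_zero (𝕜 := ℝ), ← h0]
    simp_rw [sum_inner, inner_sum, real_inner_smul_left, real_inner_smul_right, inner_kerSection,
      kerSection_apply]
    refine Finset.sum_congr rfl fun l _ => Finset.sum_congr rfl fun j _ => ?_
    rw [k.isPosDef.1 (x j) (x l), mul_assoc]
  have hf (f : k.Space) : ∑ j, α j * f (x j) = 0 := by
    have h1 : ⟪∑ j, α j • k.kerSection (x j), f⟫_ℝ = 0 := by rw [hu, inner_zero_left]
    simpa only [sum_inner, real_inner_smul_left, kerSection_inner] using h1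
  -- Injectivity of `x` allows a bump equal to 1 at `x i` and 0 at every other `x j`.
  obtain ⟨g, h1, h2, hc, -⟩ := exists_continuous_one_zero_of_isCompact
    (isCompact_singleton (x := x i)) ((Set.finite_range x).subset
      (Set.image_subset_range x {i}ᶜ)).isClosed
    (Set.disjoint_singleton_left.2 fun ⟨j, hj, hij⟩ => hj (hx hij))
  have hg : ∑ j, α j * g (x j) = α i := by
    rw [Finset.sum_eq_single i, h1 rfl]
    · simp
    · intro j _ hj
      rw [h2 ⟨j, hj, rfl⟩]
      simp
    · simp
  refine eq_of_forall_dist_le fun ε hε => ?_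
  have hA : 0 < ∑ j, |α j| + 1 := by positivity
  obtain ⟨f, hfg⟩ := h (Set.range x) (Set.finite_range x) ⟨g, hc⟩ (ε / (∑ j, |α j| + 1))
    (by positivity)
  rw [Real.dist_0_eq_abs, ← hg, ← sub_zero (∑ j, α j * g (x j)), ← hf f, abs_sub_comm,
    ← Finset.sum_sub_distrib]
  calc |∑ j, (α j * f (x j) - α j * g (x j))|
      ≤ ∑ j, |α j * f (x j) - α j * g (x j)| := Finset.abs_sum_le_sum_abs _ _
    _ ≤ ∑ j, |α j| * (ε / (∑ j, |α j| + 1)) := by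
      refine Finset.sum_le_sum fun j _ => ?_
      rw [← mul_sub, abs_mul]
      exact mul_le_mul_of_nonneg_left (hfg _ ⟨j, rfl⟩) (abs_nonneg _)
    _ ≤ (∑ j, |α j| + 1) * (ε / (∑ j, |α j| + 1)) := by
      rw [← Finset.sum_mul]
      exact mul_le_mul_of_nonneg_right (by linarith) (by positivity)
    _ = ε := mul_div_cancel₀ _ hA.ne'

end PDKernel

/-- Both pushforwards are carried by the closed set `Z`, so the support of their difference is a
closed subset of a compact set. -/
theorem sub_map_val_mem_Mbc {X : Type*} [TopologicalSpace X] [T2Space X] [MeasurableSpace X]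
    [BorelSpace X] {Z : Set X} (hZ : IsCompact Z) (p n : Measure Z) [IsFiniteMeasure p]
    [IsFiniteMeasure n] [p.InnerRegular] [n.InnerRegular] :
    (p.map Subtype.val).toSignedMeasure - (n.map Subtype.val).toSignedMeasure ∈ Mbc X := by
  have hp := Measure.InnerRegular.map_of_continuous (μ := p) continuous_subtype_val
  have hn := Measure.InnerRegular.map_of_continuous (μ := n) continuous_subtype_val
  have he : MeasurableEmbedding (Subtype.val : Z → X) :=
    MeasurableEmbedding.subtype_coe hZ.measurableSet
  refine ⟨sub_mem_Mb _ _, hZ.of_isClosed_subset Measure.isClosed_support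
    (Measure.support_subset_of_isClosed hZ.isClosed ?_)⟩
  rw [mem_ae_iff]
  refine le_antisymm ((totalVariation_sub_le _ _ _).trans ?_) bot_le
  simp [he.map_apply]

/-! ### The universality criteria. -/

namespace PDKernel

open CompactlySupported

variable {X : Type*} [TopologicalSpace X] {k : PDKernel X}

theorem IsBoundedC0.exists_zeroAtInfty (hk : k.IsBoundedC0) (f : k.Space) :
    ∃ g : C₀(X, ℝ), ⇑g = f := by
  obtain ⟨⟨C, hC⟩, h⟩ := hk
  have hs (y : X) : ∃ g : C₀(X, ℝ), ⇑g = fun x => k x y := (h y).imp fun _ hg => funext hg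
  refine ⟨⟨⟨f, continuous_apply hC (fun y => ?_) f⟩, tendsto_cocompact_zero hC (fun y => ?_) f⟩,
    rfl⟩
  · obtain ⟨g, hg⟩ := hs y
    exact hg ▸ g.continuous
  · obtain ⟨g, hg⟩ := hs y
    exact hg ▸ g.zero_at_infty'

theorem IsBoundedC0.continuous_section (hk : k.IsBoundedC0) (y : X) :
    Continuous fun x => k x y := by
  obtain ⟨g, hg⟩ := hk.2 y
  exact (funext hg : ⇑g = fun x => k x y) ▸ g.continuous

theorem IsBoundedContinuous.continuous_section (hk : k.IsBoundedContinuous) (y : X) :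
    Continuous fun x => k x y :=
  hk.1.comp (continuous_id.prodMk continuous_const)

variable (k) in
/-- The restrictions to `Z` of functions in the reproducing kernel Hilbert space that are
continuous and vanish at infinity on `Z`. -/
noncomputable def restrictC0 {Z : Type*} [TopologicalSpace Z] (i : Z → X) :
    Submodule ℝ C₀(Z, ℝ) where
  carrier := {g | ∃ f : k.Space, ∀ z, g z = f (i z)}
  add_mem' := by
    rintro _ _ ⟨f, hf⟩ ⟨g, hg⟩
    exact ⟨f + g, fun z => by simp [hf z, hg z]⟩
  zero_mem' := ⟨0, fun z => by simp⟩
  smul_mem' := by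
    rintro c _ ⟨f, hf⟩
    exact ⟨c • f, fun z => by simp [hf z]⟩

theorem isBoundedC0_of_compactSpace [CompactSpace X]
    (hk : Continuous fun p : X × X => k p.1 p.2) : k.IsBoundedC0 := by
  obtain ⟨C, hC⟩ := isCompact_univ.exists_bound_of_continuousOn hk.continuousOn
  exact ⟨⟨C, fun x y => hC (x, y) trivial⟩, fun y =>
    ⟨ZeroAtInftyContinuousMap.ContinuousMap.liftZeroAtInfty
    ⟨fun x => k x y, hk.comp (continuous_id.prodMk continuous_const)⟩, fun _ => rfl⟩⟩

theorem isCUniversal_iff_isC0Universal [CompactSpace X]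
    (hk : Continuous fun p : X × X => k p.1 p.2) : k.IsCUniversal ↔ k.IsC0Universal :=
  ⟨fun h => ⟨isBoundedC0_of_compactSpace hk, fun g => h.2 g⟩,
    fun h => ⟨hk, fun g => h.2 (ZeroAtInftyContinuousMap.ContinuousMap.liftZeroAtInfty g)⟩⟩

variable [T2Space X] [LocallyCompactSpace X] [MeasurableSpace X] [BorelSpace X]

theorem isC0Universal_iff (hk : k.IsBoundedC0) :
    k.IsC0Universal ↔ ∀ μ ∈ Mb X, μ ≠ 0 → 0 < k.energy μ := by
  obtain ⟨C, hC⟩ := hk.1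
  have hpos (μ : SignedMeasure X) := energy_pos_iff hC hk.continuous_section μ
  constructor
  · rintro ⟨-, hu⟩ μ hμ h0
    rw [hpos]
    by_contra! hf
    refine h0 (eq_zero_of_signedIntegral_eq_zero hμ fun g => ?_)
    have := isFiniteMeasure_variation μ
    -- `V` is the constant in the bound of the integral against `μ` by the sup norm; dividing by `V
    -- + 1` avoids a zero denominator.
    let V := ‖(ContinuousLinearMap.lsmul ℝ ℝ : ℝ →L[ℝ] ℝ →L[ℝ] ℝ).flip‖ *
      μ.variation.real Set.univ
    have hV : 0 ≤ V := by positivity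
    refine eq_of_forall_dist_le fun ε hε => ?_
    obtain ⟨f, hfg⟩ := hu (g : C₀(X, ℝ)) (ε / (V + 1)) (by positivity)
    have hfi : μ.Integrable f :=
      integrable_variation_of_bounded (continuous_apply hC hk.continuous_section f)
        (abs_apply_le hC f)
    rw [dist_comm, ← hf f, dist_eq_norm,
      ← VectorMeasure.integral_fun_sub hfi (integrable_compactlySupported _ g)]
    refine (VectorMeasure.norm_integral_le_of_norm_le_const (.of_forall hfg)).trans ?_
    rw [mul_assoc]
    change ε / (V + 1) * V ≤ ε
    rw [div_mul_eq_mul_div, div_le_iff₀ (by positivity)]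
    nlinarith
  · intro h
    refine ⟨hk, fun g ε hε => ?_⟩
    have hsep (p n : Measure X) (hp : IsFiniteMeasure p) (hn : IsFiniteMeasure n)
        (hpr : p.Regular) (hnr : n.Regular)
        (hpn : ∀ f ∈ k.restrictC0 (id : X → X), ∫ x, f x ∂p = ∫ x, f x ∂n) : p = n := by
      by_contra hne
      obtain ⟨f, hf⟩ := (hpos _).1 (h _ (sub_mem_Mb p n) (mt toSignedMeasure_sub_eq_zero_iff.1 hne))
      obtain ⟨g, hg⟩ := hk.exists_zeroAtInfty f
      rw [← hg, signedIntegral_sub (integrable_zeroAtInfty _ g) (integrable_zeroAtInfty _ g),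
        hpn g ⟨f, fun z => by rw [hg]; rfl⟩, sub_self] at hf
      exact hf rfl
    obtain ⟨f, ⟨f', hf'⟩, hfg⟩ := exists_mem_abs_sub_le_of_separating _ hsep g hε
    exact ⟨f', fun x => hf' x ▸ hfg x⟩

theorem isCCUniversal_iff (hk : k.IsBoundedContinuous) :
    k.IsCCUniversal ↔ ∀ μ ∈ Mbc X, μ ≠ 0 → 0 < k.energy μ := by
  obtain ⟨C, hC⟩ := hk.2
  have hpos (μ : SignedMeasure X) := energy_pos_iff hC hk.continuous_section μ
  have hcont (f : k.Space) := continuous_apply hC hk.continuous_section f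
  constructor
  · rintro ⟨-, hu⟩ μ ⟨hμ, hZ⟩ h0
    rw [hpos]
    by_contra! hf
    refine h0 (eq_zero_of_signedIntegral_eq_zero hμ fun g => ?_)
    have := isFiniteMeasure_variation μ
    let V := ‖(ContinuousLinearMap.lsmul ℝ ℝ : ℝ →L[ℝ] ℝ →L[ℝ] ℝ).flip‖ *
      μ.variation.real Set.univ
    have hV : 0 ≤ V := by positivity
    refine eq_of_forall_dist_le fun ε hε => ?_
    obtain ⟨f, hfg⟩ := hu _ hZ ((g : C(X, ℝ)).restrict _) (ε / (V + 1)) (by positivity)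
    -- Approximation on the support suffices: inner regularity makes its complement null.
    have hae : ∀ᵐ x ∂μ.variation, ‖f x - g x‖ ≤ ε / (V + 1) := by
      have hr : μ.totalVariation.InnerRegular := hμ
      have hs := Measure.support_mem_ae_of_innerRegular (μ := μ.totalVariation)
      rw [← SignedMeasure.totalVariation_eq_variation]
      filter_upwards [hs] with x hx using hfg ⟨x, hx⟩
    rw [dist_comm, ← hf f, dist_eq_norm, ← VectorMeasure.integral_fun_sub
      (integrable_variation_of_bounded (hcont f) (abs_apply_le hC f))
      (integrable_compactlySupported _ g)]
    refine (VectorMeasure.norm_integral_le_of_norm_le_const hae).trans ?_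
    rw [mul_assoc]
    change ε / (V + 1) * V ≤ ε
    rw [div_mul_eq_mul_div, div_le_iff₀ (by positivity)]
    nlinarith
  · intro h
    refine ⟨hk.1, fun Z hZ g ε hε => ?_⟩
    have : CompactSpace Z := isCompact_iff_compactSpace.1 hZ
    have he : MeasurableEmbedding (Subtype.val : Z → X) :=
      MeasurableEmbedding.subtype_coe hZ.measurableSet
    have hsep (p n : Measure Z) (hp : IsFiniteMeasure p) (hn : IsFiniteMeasure n)
        (hpr : p.Regular) (hnr : n.Regular)
        (hpn : ∀ f ∈ k.restrictC0 (Subtype.val : Z → X), ∫ x, f x ∂p = ∫ x, f x ∂n) : p = n := by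
      by_contra hne
      -- Pushing forward along the measurable embedding of `Z` loses nothing, since `comap` inverts
      -- it.
      have hne' : p.map Subtype.val ≠ n.map Subtype.val := fun h' => hne <| by
        rw [← he.comap_map p, h', he.comap_map]
      obtain ⟨f, hf⟩ := (hpos _).1 (h _ (sub_map_val_mem_Mbc hZ p n)
        (mt toSignedMeasure_sub_eq_zero_iff.1 hne'))
      have hint (q : Measure X) [IsFiniteMeasure q] : Integrable f q :=
        (BoundedContinuousFunction.ofNormedAddCommGroup f (hcont f) _
          (abs_apply_le hC f)).integrable _
      rw [signedIntegral_sub (hint _) (hint _), he.integral_map, he.integral_map, sub_ne_zero] at hf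
      let g : C(Z, ℝ) := ⟨fun z => f z, (hcont f).comp continuous_subtype_val⟩
      exact hf (hpn (ZeroAtInftyContinuousMap.ContinuousMap.liftZeroAtInfty g) ⟨f, fun _ => rfl⟩)
    obtain ⟨f, ⟨f', hf'⟩, hfg⟩ := exists_mem_abs_sub_le_of_separating _ hsep
      (ZeroAtInftyContinuousMap.ContinuousMap.liftZeroAtInfty g) hε
    exact ⟨f', fun x => hf' x ▸ hfg x⟩

end PDKernel

theorem mainTheorem2 {X : Type*} [TopologicalSpace X] [T2Space X] [LocallyCompactSpace X]
    [MeasurableSpace X] [BorelSpace X] (k : PDKernel X) :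
    (CompactSpace X → Continuous (fun p : X × X => k p.1 p.2) →
      (k.IsCUniversal ↔ ∀ μ ∈ Mb X, μ ≠ 0 → 0 < k.energy μ)) ∧
    (k.IsBoundedContinuous →
      (k.IsCCUniversal ↔ ∀ μ ∈ Mbc X, μ ≠ 0 → 0 < k.energy μ)) ∧
    (k.IsBoundedC0 →
      (k.IsC0Universal ↔ ∀ μ ∈ Mb X, μ ≠ 0 → 0 < k.energy μ)) ∧
    ((CompactSpace X → k.IsCUniversal → IsStrictlyPosDef k) ∧
      (k.IsBoundedContinuous → k.IsCCUniversal → IsStrictlyPosDef k) ∧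
      (k.IsC0Universal → IsStrictlyPosDef k)) := by
  refine ⟨fun _ hk => ?_, PDKernel.isCCUniversal_iff, PDKernel.isC0Universal_iff, fun _ h => ?_,
    fun _ h => ?_, fun h => ?_⟩
  · rw [PDKernel.isCUniversal_iff_isC0Universal hk]
    exact PDKernel.isC0Universal_iff (PDKernel.isBoundedC0_of_compactSpace hk)
  · exact PDKernel.isStrictlyPosDef_of_approx fun Z _ g ε hε =>
      (h.2 g ε hε).imp fun f hf z _ => hf z
  · exact PDKernel.isStrictlyPosDef_of_approx fun Z hZ g ε hε =>
      (h.2 Z hZ.isCompact ((g : C(X, ℝ)).restrict Z) ε hε).imp fun f hf z hz => hf ⟨z, hz⟩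
  · exact PDKernel.isStrictlyPosDef_of_approx fun Z _ g ε hε =>
      (h.2 (g : C₀(X, ℝ)) ε hε).imp fun f hf z _ => hf z
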